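/- Let $K$ be a field and let $E=(E^0,E^1,r,s)$ be a finite directed graph ($E^0$ and $E^1$ are finite; loops and multiple edges are allowed; $s(e)$ and $r(e)$ are the source and the range of the edge $e$). Let $L_K(E)$ be the Leavitt path algebra of $E$: the associative $K$-algebra generated by $\{v : v\in E^0\}\cup\{e,e^* : e\in E^1\}$ subject to $vw=\delta_{v,w}v$ for $v,w\in E^0$; $s(e)e=e=e\,r(e)$ and $r(e)e^*=e^*=e^*s(e)$ for $e\in E^1$; $e^*f=\delta_{e,f}r(e)$ for $e,f\in E^1$; and $v=\sum_{s(e)=v}ee^*$ for every $v\in E^0$ that is not a sink (so $1=\sum_{v\in E^0}v$). Its Gelfand--Kirillov dimension is $\operatorname{GKdim}L_K(E)=\sup_W\limsup_{n\to\infty}\frac{\ln\dim_K W^n}{\ln n}\in[0,\infty]$ (with the convention $\ln 0=0$), where $W$ runs over the finite-dimensional subspaces and $W^n$ is the span of all products of at least one and at most $n$ elements of $W$; every finite-dimensional generating subspace attains the supremum. Let $T_E$ be the talented monoid of $E$: the commutative monoid generated by $\{v(i) : v\in E^0,\ i\in\mathbb Z\}$ subject to $v(i)=\sum_{s(e)=v}r(e)(i+1)$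 for every $i\in\mathbb Z$ and every $v\in E^0$ that is not a sink, with the $\mathbb Z$-action ${}^nv(i)=v(i+n)$. A $\mathbb Z$-order-ideal of $T_E$ is a nonempty subset $I$ such that for all $m,n\in\mathbb Z$ and $a,b\in T_E$ one has ${}^ma+{}^nb\in I$ if and only if $a,b\in I$. For $v\in E^0$ let $\langle v\rangle$ be the smallest $\mathbb Z$-order-ideal of $T_E$ that contains $v(0)$, and let $\langle v\rangle\cap E^0$ denote the set of all vertices $u\in E^0$ with $u(0)\in\langle v\rangle$. Then the following are equivalent: (a) $E$ is a disjoint union of isolated vertices and isolated loops, that is, for every vertex $v$, either no edge starts or ends at $v$, or exactly one edge starts or ends at $v$ and this edge is a loop; (b) $\operatorname{GKdim}L_K(E)\le 1$, and $\langle v\rangle\cap E^0=\{v\}$ for every $v\in E^0$. -/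

import Mathlib

/-!  We regard a directed graph `E` as a quiver on its type `V` of vertices. Its type of edges is
`Quiver.Total V`; the source of an edge `e` is `e.left`, its range is `e.right`. Parallel edges
and loops are allowed. -/

universe u w

namespace LPA

open scoped Classical in
/-- The edges `s⁻¹(v)` that start at the vertex `v`. -/
noncomputable def outEdges {V : Type u} [Quiver.{w} V] [Fintype (Quiver.Total V)] (v : V) :
    Finset (Quiver.Total V) :=
  Finset.univ.filter fun e => e.left = v

/-- `v` is an isolated vertex: no edge starts or ends at `v`. -/
def IsIsolatedVertex {V : Type u} [Quiver.{w} V] (v : V) : Prop :=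
  ∀ e : Quiver.Total V, e.left ≠ v ∧ e.right ≠ v

/-- `v` is the base of an isolated loop: there is a loop at `v`, and no other edge starts or
ends at `v`. -/
def IsIsolatedLoop {V : Type u} [Quiver.{w} V] (v : V) : Prop :=
  ∃ e : Quiver.Total V, e.left = v ∧ e.right = v ∧
    ∀ f : Quiver.Total V, f.left = v ∨ f.right = v → f = e

/-- The graph is a disjoint union of isolated vertices and (isolated) loops: every connected
component is a single vertex without edges, or a single vertex with a single loop. -/
def IsDisjointUnionOfVerticesAndLoops (V : Type u) [Quiver.{w} V] : Prop :=
  ∀ v : V, IsIsolatedVertex v ∨ IsIsolatedLoop v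

/-! ### The Leavitt path algebra of a finite graph -/

/-- The generators `v`, `e`, `e*` of the Leavitt path algebra. -/
inductive Gen (V : Type u) [Quiver.{w} V] : Type (max u w)
  | vertex (v : V) : Gen V
  | edge (e : Quiver.Total V) : Gen V
  | ghost (e : Quiver.Total V) : Gen V

section LeavittPathAlgebra

variable (K : Type*) [Field K] (V : Type u) [Quiver.{w} V] [Fintype V]
  [Fintype (Quiver.Total V)]

/-- A generator, as an element of the free associative algebra. -/
def gen {V : Type u} [Quiver.{w} V] (x : Gen V) : FreeAlgebra K (Gen V) :=
  FreeAlgebra.ι K x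

/-- The defining relations of the Leavitt path algebra of a finite graph. The free algebra used
here is the unital one. The relations other than `unit` make the sum of all vertices a two-sided
identity for all the generators; `unit` says that this is the unit `1`, so that the quotient is
the algebra presented by the other relations among not necessarily unital algebras. -/
inductive Rel : FreeAlgebra K (Gen V) → FreeAlgebra K (Gen V) → Prop
  | vertex_self (v : V) : Rel (gen K (.vertex v) * gen K (.vertex v)) (gen K (.vertex v))
  | vertex_ne (v v' : V) : v ≠ v' → Rel (gen K (.vertex v) * gen K (.vertex v')) 0
  | source_edge (e : Quiver.Total V) :
      Rel (gen K (.vertex e.left) * gen K (.edge e)) (gen K (.edge e))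
  | edge_range (e : Quiver.Total V) :
      Rel (gen K (.edge e) * gen K (.vertex e.right)) (gen K (.edge e))
  | range_ghost (e : Quiver.Total V) :
      Rel (gen K (.vertex e.right) * gen K (.ghost e)) (gen K (.ghost e))
  | ghost_source (e : Quiver.Total V) :
      Rel (gen K (.ghost e) * gen K (.vertex e.left)) (gen K (.ghost e))
  | ck1_self (e : Quiver.Total V) :
      Rel (gen K (.ghost e) * gen K (.edge e)) (gen K (.vertex e.right))
  | ck1_ne (e f : Quiver.Total V) : e ≠ f → Rel (gen K (.ghost e) * gen K (.edge f)) 0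
  | ck2 (v : V) : (outEdges v).Nonempty →
      Rel (gen K (.vertex v)) (∑ e ∈ outEdges v, gen K (.edge e) * gen K (.ghost e))
  | unit : Rel (∑ v : V, gen K (.vertex v)) 1

/-- The Leavitt path algebra `L_K(E)` of a finite graph `E`. -/
abbrev LeavittPathAlgebra := RingQuot (Rel K V)

end LeavittPathAlgebra

/-! ### The Gelfand-Kirillov dimension -/

/-- The span of all products of `k` elements of `W` with `1 ≤ k ≤ n`. -/
def powersUpTo {K A : Type*} [Field K] [Ring A] [Algebra K A] (W : Submodule K A) (n : ℕ) :
    Submodule K A :=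
  ⨆ k ∈ Finset.Icc 1 n, W ^ k

/-- The growth exponent `limsup log (dim Wⁿ) / log n` of a finite-dimensional subspace `W`, where
`Wⁿ` is the span of all products of at most `n` elements of `W`. It is `⊤` exactly when the
growth is not polynomially bounded. -/
noncomputable def growthExponent {K A : Type*} [Field K] [Ring A] [Algebra K A]
    (W : Submodule K A) : EReal :=
  Filter.limsup
    (fun n : ℕ => ((Real.log (Module.finrank K (powersUpTo W n)) / Real.log n : ℝ) : EReal))
    Filter.atTop

/-- The Gelfand-Kirillov dimension: the supremum of the growth exponents of the finite-dimensional
subspaces. If `A` is generated by a finite-dimensional subspace, then every such generating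
subspace attains the supremum. -/
noncomputable def gkDim (K A : Type*) [Field K] [Ring A] [Algebra K A] : EReal :=
  ⨆ (W : Submodule K A) (_ : FiniteDimensional K W), growthExponent W

/-! ### Order-ideals and the talented monoid -/

/-- `Γ`-order-ideals of a commutative monoid `T` on which the group `Γ` acts by monoid
automorphisms. -/
def IsOrderIdeal (Γ : Type*) {T : Type*} [Group Γ] [AddCommMonoid T] [DistribMulAction Γ T]
    (I : Set T) : Prop :=
  I.Nonempty ∧ ∀ (α β : Γ) (a b : T), α • a + β • b ∈ I ↔ a ∈ I ∧ b ∈ I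

/-- The `Γ`-order-ideal `⟨x⟩` generated by `x`. -/
def orderIdealGen (Γ : Type*) {T : Type*} [Group Γ] [AddCommMonoid T] [DistribMulAction Γ T]
    (x : T) : Set T :=
  ⋂₀ {I : Set T | IsOrderIdeal Γ I ∧ x ∈ I}

section TalentedMonoid

variable (V : Type u) [Quiver.{w} V] [Fintype (Quiver.Total V)]

/-- The relations `v(i) = ∑ r(e)(i+1)` (sum over the edges `e` with source `v`, where `v` is not
a sink) of the talented monoid, on the free commutative monoid on the symbols `v(i)`. -/
inductive TalentedRel : ((V × ℤ) →₀ ℕ) → ((V × ℤ) →₀ ℕ) → Prop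
  | expand (v : V) (i : ℤ) : (outEdges v).Nonempty →
      TalentedRel (Finsupp.single (v, i) 1)
        (∑ e ∈ outEdges v, Finsupp.single (e.right, i + 1) 1)

/-- The talented monoid `T_E`. -/
def TalentedMonoid : Type u := (addConGen (TalentedRel V)).Quotient

noncomputable instance : AddCommMonoid (TalentedMonoid V) :=
  inferInstanceAs (AddCommMonoid (addConGen (TalentedRel V)).Quotient)

variable {V}

/-- The element `v(i)` of the talented monoid. -/
noncomputable def TalentedMonoid.of (v : V) (i : ℤ) : TalentedMonoid V :=
  (addConGen (TalentedRel V)).mk' (Finsupp.single (v, i) 1)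

variable (V)

/-- The shift `v(i) ↦ v(i + n)` on the free commutative monoid. -/
noncomputable def shiftFree (n : ℤ) : ((V × ℤ) →₀ ℕ) →+ ((V × ℤ) →₀ ℕ) :=
  Finsupp.mapDomain.addMonoidHom fun p => (p.1, p.2 + n)

/-- The shift `v(i) ↦ v(i + n)` on the talented monoid. -/
noncomputable def TalentedMonoid.shift (n : ℤ) : TalentedMonoid V →+ TalentedMonoid V :=
  (addConGen (TalentedRel V)).lift ((addConGen (TalentedRel V)).mk'.comp (shiftFree V n)) <| by
    refine AddCon.addConGen_le.2 ?_
    rintro _ _ ⟨v, i, hv⟩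
    refine (AddCon.eq _).2 ?_
    have h := AddConGen.Rel.of _ _ (TalentedRel.expand v (i + n) hv)
    change (addConGen (TalentedRel V)) _ _ at h
    simpa [shiftFree, Finsupp.mapDomain_single, Finsupp.mapDomain_finsetSum, add_right_comm]
      using h

variable {V}

theorem TalentedMonoid.shift_of (n : ℤ) (v : V) (i : ℤ) :
    TalentedMonoid.shift V n (TalentedMonoid.of v i) = TalentedMonoid.of v (i + n) := by
  change (addConGen (TalentedRel V)).mk' (shiftFree V n (Finsupp.single (v, i) 1)) = _
  simp [shiftFree, TalentedMonoid.of, Finsupp.mapDomain_single]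

theorem TalentedMonoid.hom_ext {M : Type*} [AddCommMonoid M] {f g : TalentedMonoid V →+ M}
    (h : ∀ v i, f (TalentedMonoid.of v i) = g (TalentedMonoid.of v i)) : f = g := by
  refine AddCon.hom_ext (c := addConGen (TalentedRel V)) ?_
  refine Finsupp.addHom_ext' fun p => ?_
  refine AddMonoidHom.ext_nat ?_
  exact h p.1 p.2

/-- The `ℤ`-action `ⁿv(i) = v(i + n)` on the talented monoid (`ℤ` written multiplicatively). -/
noncomputable instance : DistribMulAction (Multiplicative ℤ) (TalentedMonoid V) where
  smul n x := TalentedMonoid.shift V n.toAdd x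
  one_smul x := by
    have h : TalentedMonoid.shift V 0 = AddMonoidHom.id _ :=
      TalentedMonoid.hom_ext fun v i => by simp [TalentedMonoid.shift_of]
    exact DFunLike.congr_fun h x
  mul_smul m n x := by
    have h : TalentedMonoid.shift V (m.toAdd + n.toAdd) =
        (TalentedMonoid.shift V m.toAdd).comp (TalentedMonoid.shift V n.toAdd) :=
      TalentedMonoid.hom_ext fun v i => by
        simp [TalentedMonoid.shift_of, add_assoc, add_comm m.toAdd]
    exact DFunLike.congr_fun h x
  smul_zero n := map_zero (TalentedMonoid.shift V n.toAdd)
  smul_add n := map_add (TalentedMonoid.shift V n.toAdd)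

end TalentedMonoid

/-- The set `⟨v⟩ ∩ E⁰` of all vertices `u` for which `u = u(0)` lies in the `ℤ`-order-ideal of the
talented monoid generated by `v = v(0)`. -/
def idealVertices {V : Type u} [Quiver.{w} V] [Fintype (Quiver.Total V)] (v : V) : Set V :=
  {u | TalentedMonoid.of u 0 ∈ orderIdealGen (Multiplicative ℤ) (TalentedMonoid.of v 0)}

end LPA

/-! In a disjoint union of vertices and loops, the corner at each vertex contains mutually inverse
elements (a loop and its ghost, or the vertex twice). Their sums over all vertices give a unit `x`
commuting with the vertices, and the elements `v x^k` span the algebra, so it grows linearly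
(`gkDim_le_one`). In the talented monoid, counting occurrences of `u` is then a shift-invariant
homomorphism to `ℕ`; its kernel separates `u` from any other `v` (`idealVertices_eq_singleton`).

Conversely, `r(e)` always lies in `⟨s(e)⟩` (`right_mem_idealVertices`), so singleton ideals force
every edge to be a loop. Two loops at one vertex would give `2 ^ n` independent words of length `n`,
hence exponential growth (`one_lt_gkDim_of_isometries`). That argument needs the vertex to be
nonzero, which a representation on functions of infinite paths shows (`vtx_ne_zero`). -/

namespace LPA

open Filter Topology

/-! ### Growth -/

section Growth

variable {K A : Type*} [Field K] [Ring A] [Algebra K A]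

/-- An upper bound for the growth exponent of a subspace of linear growth. -/
theorem growthExponent_le_one_of_linear {W : Submodule K A} {C : ℕ}
    (h : ∀ n : ℕ, 1 ≤ n → Module.finrank K (powersUpTo W n) ≤ C * n) :
    growthExponent W ≤ 1 := by
  -- `C + 1` replaces `C` so that the logarithm of the product splits even if `C = 0`.
  have hlim : Tendsto (fun n : ℕ => ((Real.log (C + 1) / Real.log n + 1 : ℝ) : EReal)) atTop
      (𝓝 ((0 + 1 : ℝ) : EReal)) :=
    (continuous_coe_real_ereal.tendsto _).comp <|
      ((Real.tendsto_log_atTop.comp tendsto_natCast_atTop_atTop).const_div_atTop _).add_const 1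
  have hle : growthExponent W ≤
      limsup (fun n : ℕ => ((Real.log (C + 1) / Real.log n + 1 : ℝ) : EReal)) atTop := by
    refine limsup_le_limsup ?_
    filter_upwards [eventually_ge_atTop 2] with n hn
    have hn' : (2 : ℝ) ≤ n := by exact_mod_cast hn
    have hlog : 0 < Real.log n := Real.log_pos (by linarith)
    refine EReal.coe_le_coe_iff.2 ?_
    have hsum : Real.log (C + 1) / Real.log n + 1 = Real.log ((C + 1) * n) / Real.log n := by
      rw [Real.log_mul (by positivity) (by positivity)]
      field_simp
    rw [hsum]
    refine div_le_div_of_nonneg_right ?_ hlog.le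
    -- Dimension zero is separate: there `Real.log 0 = 0`, and monotonicity of the logarithm is not
    -- available.
    rcases Nat.eq_zero_or_pos (Module.finrank K (powersUpTo W n)) with h0 | h0
    · rw [h0, Nat.cast_zero, Real.log_zero]
      exact Real.log_nonneg (by nlinarith [(Nat.cast_nonneg C : (0 : ℝ) ≤ C)])
    · refine Real.log_le_log (by exact_mod_cast h0) ?_
      have := h n (by omega)
      have : (Module.finrank K (powersUpTo W n) : ℝ) ≤ C * n := by exact_mod_cast this
      linarith
  rw [hlim.limsup_eq] at hle
  simpa using hle

/-- The induction starts at the first power, since `F 0` is not assumed to contain `1`. -/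
theorem powersUpTo_le {W : Submodule K A} {F : ℕ → Submodule K A} (hmono : Monotone F)
    (hmul : ∀ m n, F m * F n ≤ F (m + n)) {m : ℕ} (hW : W ≤ F m) (n : ℕ) :
    powersUpTo W n ≤ F (n * m) := by
  have hpow : ∀ k : ℕ, W ^ (k + 1) ≤ F ((k + 1) * m) := by
    intro k
    induction k with
    | zero => simpa using hW
    | succ k ih =>
      rw [pow_succ, add_mul _ 1 m, one_mul]
      exact (mul_le_mul' ih hW).trans (hmul _ _)
  refine iSup₂_le fun k hk => ?_
  obtain ⟨h1, h2⟩ := Finset.mem_Icc.1 hk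
  obtain ⟨j, rfl⟩ := Nat.exists_eq_add_of_le' h1
  exact (hpow j).trans (hmono (Nat.mul_le_mul_right m h2))

/-- An exhaustive multiplicative filtration of linear growth bounds the Gelfand-Kirillov dimension
by one. -/
theorem gkDim_le_one_of_filtration {F : ℕ → Submodule K A} (hmono : Monotone F)
    (hmul : ∀ m n, F m * F n ≤ F (m + n)) (hex : ∀ a, ∃ m, a ∈ F m)
    (hfin : ∀ m, FiniteDimensional K (F m)) {C : ℕ}
    (hrank : ∀ m, Module.finrank K (F m) ≤ C * (2 * m + 1)) : gkDim K A ≤ 1 := by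
  refine iSup₂_le fun W hW => ?_
  obtain ⟨m, hm⟩ : ∃ m, W ≤ F m := by
    obtain ⟨s, hs⟩ := Module.Finite.iff_fg.1 hW
    choose d hd using hex
    refine ⟨s.sup d, ?_⟩
    rw [← hs, Submodule.span_le]
    exact fun a ha => hmono (Finset.le_sup (f := d) ha) (hd a)
  refine growthExponent_le_one_of_linear (C := C * (2 * m + 1)) fun n hn => ?_
  refine (Submodule.finrank_mono (powersUpTo_le hmono hmul hm n)).trans ((hrank _).trans ?_)
  rw [mul_assoc]
  refine Nat.mul_le_mul_left C ?_
  nlinarith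

/-- If `W ^ n` has dimension at least `2 ^ n` for all `n`, then the Gelfand-Kirillov dimension
exceeds one. -/
theorem one_lt_gkDim_of_two_pow_le {W : Submodule K A} [FiniteDimensional K W]
    (h : ∀ n : ℕ, 2 ^ n ≤ Module.finrank K (W ^ n : Submodule K A)) : 1 < gkDim K A := by
  have hW : W.FG := Module.Finite.iff_fg.1 inferInstance
  have hfin : ∀ n, FiniteDimensional K (powersUpTo W n) := fun n =>
    Module.Finite.iff_fg.2 (Submodule.fg_biSup _ _ fun k _ => hW.pow k)
  have hlt : (1 : EReal) < ((2 : ℝ) : EReal) := by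
    rw [← EReal.coe_one]
    exact EReal.coe_lt_coe_iff.2 (by norm_num)
  refine hlt.trans_le (le_trans ?_ (le_iSup₂_of_le W inferInstance le_rfl))
  refine le_limsup_of_frequently_le (Eventually.frequently ?_)
  have hlog2 : 0 < Real.log 2 := Real.log_pos (by norm_num)
  -- Eventually `log n ≤ (log 2 / 2) * n`, so `2 * log n ≤ log (2 ^ n)`; this yields the exponent
  -- `2`, and any bound above `1` would do.
  have ho := (Real.isLittleO_log_id_atTop.comp_tendsto tendsto_natCast_atTop_atTop).def
    (half_pos hlog2)
  filter_upwards [ho, eventually_ge_atTop 2] with n ho hn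
  have hn' : (2 : ℝ) ≤ n := by exact_mod_cast hn
  have hlog : 0 < Real.log n := Real.log_pos (by linarith)
  refine EReal.coe_le_coe_iff.2 ?_
  rw [le_div_iff₀ hlog]
  simp only [Function.comp_apply, id_eq, Real.norm_eq_abs, abs_of_pos hlog,
    abs_of_nonneg (Nat.cast_nonneg n : (0 : ℝ) ≤ n)] at ho
  have hle : W ^ n ≤ powersUpTo W n :=
    le_iSup₂_of_le n (Finset.mem_Icc.2 ⟨by omega, le_rfl⟩) le_rfl
  have hrank : (2 : ℝ) ^ n ≤ Module.finrank K (powersUpTo W n) := by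
    exact_mod_cast (h n).trans (Submodule.finrank_mono hle)
  calc 2 * Real.log n ≤ n * Real.log 2 := by linarith
    _ = Real.log (2 ^ n) := (Real.log_pow _ _).symm
    _ ≤ _ := Real.log_le_log (by positivity) hrank

/-- Two isometries with orthogonal ranges over a nonzero idempotent generate a subalgebra of
exponential growth. -/
theorem one_lt_gkDim_of_isometries {p : A} (hp : p ≠ 0) (hpp : p * p = p) {s t : Bool → A}
    (hps : ∀ i, p * s i = s i) (hts : ∀ i j, t i * s j = if i = j then p else 0) :
    1 < gkDim K A := by
  let mon : (n : ℕ) → (Fin n → Bool) → A := fun n w => (List.ofFn fun i => s (w i)).prod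
  have hmon : ∀ n (i : Bool) (w : Fin n → Bool), mon (n + 1) (Fin.cons i w) = s i * mon n w := by
    intro n i w
    simp [mon, List.ofFn_succ]
  -- Multiplying by `t (w 0)` kills the words with another first letter and strips this letter from
  -- the rest, leaving a factor `p`. The right factor `p` lets this be absorbed even for the empty
  -- word.
  have hind : ∀ n, LinearIndependent K fun w : Fin n → Bool => mon n w * p := by
    intro n
    induction n with
    | zero =>
      refine linearIndependent_unique_iff.2 ?_
      simpa [mon] using hp
    | succ n ih =>
      rw [Fintype.linearIndependent_iff] at ih ⊢
      intro c hc w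
      have hpm : ∀ w : Fin n → Bool, p * (mon n w * p) = mon n w * p := by
        intro w
        cases n with
        | zero =>
          simpa [mon] using hpp
        | succ n =>
          rw [← Fin.cons_self_tail w, hmon, ← mul_assoc, ← mul_assoc, hps]
      have hterm : ∀ (i : Bool) (w' : Fin n → Bool),
          t (w 0) * (c (Fin.cons i w') • (mon (n + 1) (Fin.cons i w') * p)) =
            if w 0 = i then c (Fin.cons i w') • (mon n w' * p) else 0 := by
        intro i w'
        rw [hmon, mul_smul_comm, mul_assoc, ← mul_assoc (t _), hts]
        split_ifs
        · rw [hpm]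
        · rw [zero_mul, smul_zero]
      refine (Fin.cons_self_tail w) ▸ ih (fun w' => c (Fin.cons (w 0) w')) ?_ (Fin.tail w)
      have h2 := congrArg (t (w 0) * ·) hc
      simp only [mul_zero, Finset.mul_sum] at h2
      rw [← h2, ← (Fin.consEquiv fun _ : Fin (n + 1) => Bool).sum_comp, Fintype.sum_prod_type,
        Finset.sum_eq_single (w 0)]
      · exact Finset.sum_congr rfl fun w' _ => ((hterm (w 0) w').trans (if_pos rfl)).symm
      · exact fun i _ hi => Finset.sum_eq_zero fun w' _ => (hterm i w').trans (if_neg hi.symm)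
      · simp
  let W : Submodule K A := Submodule.span K (Set.range s)
  have : FiniteDimensional K W := FiniteDimensional.span_of_finite K (Set.finite_range s)
  refine one_lt_gkDim_of_two_pow_le (W := W) fun n => ?_
  have hind' : LinearIndependent K (mon n) :=
    LinearIndependent.of_comp (LinearMap.mulRight K p) (hind n)
  have hmem : ∀ n (w : Fin n → Bool), mon n w ∈ W ^ n := by
    intro n
    induction n with
    | zero => intro w; exact Submodule.one_le.1 (pow_zero W).ge
    | succ n ih =>
      intro w
      rw [← Fin.cons_self_tail w, hmon, pow_succ']
      exact Submodule.mul_mem_mul (Submodule.subset_span ⟨_, rfl⟩) (ih _)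
  have : FiniteDimensional K (W ^ n : Submodule K A) :=
    Module.Finite.iff_fg.2 ((Module.Finite.iff_fg.1 ‹_› : W.FG).pow n)
  have hcard := (LinearIndependent.of_comp (W ^ n).subtype
    (v := fun w : Fin n → Bool => (⟨mon n w, hmem n w⟩ : (W ^ n : Submodule K A)))
    hind').fintype_card_le_finrank
  simpa using hcard

/-- An algebra spanned by the products of orthogonal idempotents, whose sum is `1`, with the powers
of a unit that commutes with them has Gelfand-Kirillov dimension at most one. -/
theorem gkDim_le_one_of_unit {ι : Type*} [Fintype ι] {p : ι → A} (x : Aˣ)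
    (hpp : ∀ i, p i * p i = p i) (hne : ∀ i j, i ≠ j → p i * p j = 0)
    (hpx : ∀ i, Commute (p i) x)
    (hex : ∀ F : ℕ → Submodule K A, Monotone F → (∀ m n, F m * F n ≤ F (m + n)) →
      (∀ i, p i ∈ F 0) → (∀ i, p i * x ∈ F 1) → (∀ i, p i * (x⁻¹ : Aˣ) ∈ F 1) →
      ∀ a, ∃ m, a ∈ F m) :
    gkDim K A ≤ 1 := by
  let b : ι → ℤ → A := fun i k => p i * ((x ^ k : Aˣ) : A)
  -- Degree filtration by `|k| ≤ m`: each index contributes at most `2 * m + 1` generators.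
  let F : ℕ → Submodule K A := fun m =>
    Submodule.span K (Set.range fun q : ι × Finset.Icc (-(m : ℤ)) m => b q.1 q.2)
  have hb : ∀ i (k : ℤ) (m : ℕ), -(m : ℤ) ≤ k → k ≤ m → b i k ∈ F m := fun i k m h1 h2 =>
    Submodule.subset_span ⟨(i, ⟨k, Finset.mem_Icc.2 ⟨h1, h2⟩⟩), rfl⟩
  have hmono : Monotone F := by
    intro m n hmn
    refine Submodule.span_le.2 ?_
    rintro _ ⟨⟨i, k, hk⟩, rfl⟩
    rw [Finset.mem_Icc] at hk
    exact hb i k n (by omega) (by omega)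
  have hmul : ∀ m n, F m * F n ≤ F (m + n) := by
    intro m n
    refine (Submodule.span_mul_span _ _ _).trans_le (Submodule.span_le.2 ?_)
    rintro _ ⟨_, ⟨⟨i, k, hk⟩, rfl⟩, _, ⟨⟨j, l, hl⟩, rfl⟩, rfl⟩
    rw [Finset.mem_Icc] at hk hl
    have hc : Commute (p j) ((x ^ k : Aˣ) : A) := (hpx j).units_zpow_right k
    have hprod : b i k * b j l = p i * p j * ((x ^ (k + l) : Aˣ) : A) := by
      simp only [b]
      rw [zpow_add, Units.val_mul, mul_assoc, ← mul_assoc _ (p j), ← hc.eq]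
      simp only [mul_assoc]
    change b i k * b j l ∈ F (m + n)
    rw [hprod]
    by_cases hij : i = j
    · subst hij
      rw [hpp]
      exact hb i (k + l) (m + n) (by push_cast; omega) (by push_cast; omega)
    · rw [hne i j hij, zero_mul]
      exact zero_mem _
  refine gkDim_le_one_of_filtration (F := F) (C := Fintype.card ι) hmono hmul
    (hex F hmono hmul ?_ ?_ ?_) (fun m => FiniteDimensional.span_of_finite K (Set.finite_range _))
    fun m => ?_
  · intro i
    simpa [b] using hb i 0 0 (by simp) (by simp)
  · intro i
    simpa [b] using hb i 1 1 (by simp) (by simp)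
  · intro i
    simpa [b] using hb i (-1) 1 (by simp) (by simp)
  · refine (finrank_range_le_card _).trans ?_
    simp only [Fintype.card_prod, Fintype.card_coe, Int.card_Icc]
    refine Nat.mul_le_mul_left _ ?_
    omega

end Growth

theorem mem_outEdges {V : Type u} [Quiver.{w} V] [Fintype (Quiver.Total V)] {v : V}
    {e : Quiver.Total V} : e ∈ outEdges v ↔ e.left = v := by
  simp [outEdges]

/-! ### The Leavitt path algebra -/

section Algebra

variable (K : Type*) [Field K] {V : Type u} [Quiver.{w} V] [Fintype V]
  [Fintype (Quiver.Total V)]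

variable (V) in
/-- The quotient map onto the Leavitt path algebra. -/
noncomputable def quot : FreeAlgebra K (Gen V) →ₐ[K] LeavittPathAlgebra K V :=
  RingQuot.mkAlgHom K (Rel K V)

theorem quot_eq {a b : FreeAlgebra K (Gen V)} (h : Rel K V a b) : quot K V a = quot K V b :=
  RingQuot.mkAlgHom_rel K h

/-- A vertex in the Leavitt path algebra. -/
noncomputable def vtx (v : V) : LeavittPathAlgebra K V := quot K V (gen K (.vertex v))

/-- An edge in the Leavitt path algebra. -/
noncomputable def edg (e : Quiver.Total V) : LeavittPathAlgebra K V := quot K V (gen K (.edge e))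

/-- A ghost edge in the Leavitt path algebra. -/
noncomputable def gho (e : Quiver.Total V) : LeavittPathAlgebra K V := quot K V (gen K (.ghost e))

theorem vtx_mul_self (v : V) : vtx K v * vtx K v = vtx K v := by
  simpa [vtx, edg, gho] using quot_eq K (Rel.vertex_self v)

theorem vtx_mul_of_ne {v v' : V} (h : v ≠ v') : vtx K v * vtx K v' = 0 := by
  simpa [vtx, edg, gho] using quot_eq K (Rel.vertex_ne v v' h)

theorem left_mul_edg (e : Quiver.Total V) : vtx K e.left * edg K e = edg K e := by
  simpa [vtx, edg, gho] using quot_eq K (Rel.source_edge e)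

theorem edg_mul_right (e : Quiver.Total V) : edg K e * vtx K e.right = edg K e := by
  simpa [vtx, edg, gho] using quot_eq K (Rel.edge_range e)

theorem right_mul_gho (e : Quiver.Total V) : vtx K e.right * gho K e = gho K e := by
  simpa [vtx, edg, gho] using quot_eq K (Rel.range_ghost e)

theorem gho_mul_left (e : Quiver.Total V) : gho K e * vtx K e.left = gho K e := by
  simpa [vtx, edg, gho] using quot_eq K (Rel.ghost_source e)

theorem gho_mul_edg_self (e : Quiver.Total V) : gho K e * edg K e = vtx K e.right := by
  simpa [vtx, edg, gho] using quot_eq K (Rel.ck1_self e)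

theorem gho_mul_edg_of_ne {e f : Quiver.Total V} (h : e ≠ f) : gho K e * edg K f = 0 := by
  simpa [vtx, edg, gho] using quot_eq K (Rel.ck1_ne e f h)

theorem vtx_eq_sum {v : V} (h : (outEdges v).Nonempty) :
    vtx K v = ∑ e ∈ outEdges v, edg K e * gho K e := by
  simpa [vtx, edg, gho] using quot_eq K (Rel.ck2 v h)

theorem sum_vtx : ∑ v : V, vtx K v = 1 := by
  simpa [vtx, edg, gho] using quot_eq K (Rel.unit (K := K) (V := V))

/-- The action of the generators on the functions on the infinite paths, where all edges that
start or end at `v` are loops. -/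
noncomputable def pathAction (v : V) :
    Gen V → Module.End K ((ℕ → {e : Quiver.Total V // e.left = v}) → K) := by
  classical
  -- An edge `e` tests whether the path starts with `e` and then evaluates at its tail; its ghost
  -- evaluates at the path with `e` prepended. Edges away from `v` act as zero.
  exact fun
  | .vertex w => if w = v then 1 else 0
  | .edge e =>
      { toFun := fun f x => if (x 0).1 = e then f (fun n => x (n + 1)) else 0
        map_add' := fun f g => by ext x; by_cases h : (x 0).1 = e <;> simp [h]
        map_smul' := fun c f => by ext x; simp }
  | .ghost e => if h : e.left = v then
      { toFun := fun f x => f (fun n => Nat.casesOn n ⟨e, h⟩ x)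
        map_add' := fun f g => rfl
        map_smul' := fun c f => rfl } else 0

/-- If all edges that start or end at `v` are loops and there is at least one of them, then `v` is
not zero in the Leavitt path algebra. -/
theorem vtx_ne_zero {v : V} (hv : (outEdges v).Nonempty)
    (hloop : ∀ e : Quiver.Total V, e.left = v ↔ e.right = v) : vtx K v ≠ 0 := by
  classical
  have hrel : ∀ ⦃a b⦄, Rel K V a b →
      FreeAlgebra.lift K (pathAction K v) a = FreeAlgebra.lift K (pathAction K v) b := by
    have hcons : ∀ x : ℕ → {e : Quiver.Total V // e.left = v},
        (fun n : ℕ => (Nat.casesOn n (x 0) fun n => x (n + 1) :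
          {e : Quiver.Total V // e.left = v})) = x := by
      intro x
      funext n
      cases n <;> rfl
    intro a b h
    cases h with
    | vertex_self w => by_cases h : w = v <;> simp [gen, pathAction, h]
    | vertex_ne w w' hw =>
      by_cases h : w = v
      · subst h; simp [gen, pathAction, hw.symm]
      · simp [gen, pathAction, h]
    | source_edge e =>
      by_cases h : e.left = v
      · simp [gen, pathAction, h]
      · have : ∀ x : {e : Quiver.Total V // e.left = v}, x.1 ≠ e := fun x hx => h (hx ▸ x.2)
        ext f x
        simp [gen, pathAction, h, this]
    | edge_range e =>
      by_cases h : e.right = v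
      · simp [gen, pathAction, h]
      · have : ∀ x : {e : Quiver.Total V // e.left = v}, x.1 ≠ e :=
          fun x hx => h ((hloop e).1 (hx ▸ x.2))
        ext f x
        simp [gen, pathAction, h, this]
    | range_ghost e =>
      by_cases h : e.left = v
      · simp [gen, pathAction, h, (hloop e).1 h]
      · simp [gen, pathAction, h]
    | ghost_source e => by_cases h : e.left = v <;> simp [gen, pathAction, h]
    | ck1_self e =>
      by_cases h : e.left = v
      · ext f x
        simp [gen, pathAction, h, (hloop e).1 h]
      · simp [gen, pathAction, h, mt (hloop e).2 h]
    | ck1_ne e e' hne =>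
      by_cases h : e.left = v
      · ext f x
        simp [gen, pathAction, h, hne]
      · simp [gen, pathAction, h]
    | ck2 w hw =>
      by_cases h : w = v
      · subst h
        ext f x
        simp only [gen, map_sum, map_mul, FreeAlgebra.lift_ι_apply, LinearMap.sum_apply,
          Finset.sum_apply]
        -- At the path `x`, only the summand of its first edge survives; it removes that edge and
        -- puts it back.
        rw [Finset.sum_eq_single (x 0).1]
        · have := (x 0).2
          simp only [pathAction, this, dif_pos, if_pos, Module.End.mul_apply, LinearMap.coe_mk,
            AddHom.coe_mk, Module.End.one_apply]
          exact congrArg f (hcons x).symm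
        · intro e _ he
          rw [Module.End.mul_apply]
          exact if_neg he.symm
        · intro hx
          exact absurd (mem_outEdges.2 (x 0).2) hx
      · simp only [gen, map_sum, map_mul, FreeAlgebra.lift_ι_apply]
        rw [Finset.sum_eq_zero]
        · simp [pathAction, h]
        · intro e he
          rw [mem_outEdges] at he
          simp [pathAction, he, h]
    | unit => simp [gen, pathAction]
  obtain ⟨e, he⟩ := hv
  -- Repeating one loop gives an infinite path, so the function space is nonzero, and `v` acts on it
  -- as the identity.
  have : Nonempty (ℕ → {e : Quiver.Total V // e.left = v}) := ⟨fun _ => ⟨e, mem_outEdges.1 he⟩⟩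
  intro h0
  have h1 := congrArg (RingQuot.liftAlgHom K ⟨FreeAlgebra.lift K (pathAction K v), hrel⟩) h0
  simp only [vtx, quot, map_zero, RingQuot.liftAlgHom_mkAlgHom_apply, gen,
    FreeAlgebra.lift_ι_apply] at h1
  simp [pathAction] at h1

/-- Two loops at a vertex without other neighbours make the Gelfand-Kirillov dimension exceed
one. -/
theorem one_lt_gkDim_of_two_loops {v : V}
    (hloop : ∀ e : Quiver.Total V, e.left = v ↔ e.right = v) {e f : Quiver.Total V}
    (he : e.left = v) (hf : f.left = v) (hne : e ≠ f) :
    1 < gkDim K (LeavittPathAlgebra K V) := by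
  refine one_lt_gkDim_of_isometries (vtx_ne_zero K ⟨e, mem_outEdges.2 he⟩ hloop)
    (vtx_mul_self K v)
    (s := fun i => edg K (cond i e f)) (t := fun i => gho K (cond i e f)) ?_ ?_
  · rintro (_ | _)
    · simpa [hf] using left_mul_edg K f
    · simpa [he] using left_mul_edg K e
  · rintro (_ | _) (_ | _)
    · simpa [(hloop f).1 hf] using gho_mul_edg_self K f
    · simpa using gho_mul_edg_of_ne K hne.symm
    · simpa using gho_mul_edg_of_ne K hne
    · simpa [(hloop e).1 he] using gho_mul_edg_self K e

/-- For a disjoint union of vertices and loops, every vertex `v` has elements `a` and `b` that are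
inverse to each other in the corner at `v`, and every edge and ghost edge is of this form. -/
theorem exists_corner_units (h : IsDisjointUnionOfVerticesAndLoops V) (v : V) :
    ∃ a b : LeavittPathAlgebra K V, vtx K v * a = a ∧ a * vtx K v = a ∧ vtx K v * b = b ∧
      b * vtx K v = b ∧ a * b = vtx K v ∧ b * a = vtx K v ∧
      ∀ e : Quiver.Total V, e.left = v → edg K e = a ∧ gho K e = b := by
  rcases h v with h | ⟨e, hl, hr, hu⟩
  · refine ⟨vtx K v, vtx K v, ?_, ?_, ?_, ?_, ?_, ?_, fun e he => absurd he (h e).1⟩ <;>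
      exact vtx_mul_self K v
  · have hout : outEdges v = {e} := by
      ext f
      rw [mem_outEdges, Finset.mem_singleton]
      exact ⟨fun hf => hu f (.inl hf), fun hf => hf ▸ hl⟩
    refine ⟨edg K e, gho K e, ?_, ?_, ?_, ?_, ?_, ?_, fun f hf => ?_⟩
    · simpa [hl] using left_mul_edg K e
    · simpa [hr] using edg_mul_right K e
    · simpa [hr] using right_mul_gho K e
    · simpa [hl] using gho_mul_left K e
    -- With a single outgoing edge, the second Cuntz–Krieger relation reads `v = e e*`.
    · rw [vtx_eq_sum K (hout ▸ Finset.singleton_nonempty e), hout, Finset.sum_singleton]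
    · simpa [hr] using gho_mul_edg_self K e
    · rw [hu f (.inl hf)]
      exact ⟨rfl, rfl⟩

theorem gkDim_le_one (h : IsDisjointUnionOfVerticesAndLoops V) :
    gkDim K (LeavittPathAlgebra K V) ≤ 1 := by
  classical
  choose a b hpa hap hpb hbp hab hba hedge using exists_corner_units K h
  have hprod : ∀ c d : V → LeavittPathAlgebra K V, (∀ v, c v * vtx K v = c v) →
      (∀ v, vtx K v * d v = d v) → (∀ v, c v * d v = vtx K v) →
      (∑ v, c v) * ∑ v, d v = 1 := by
    intro c d hc hd hcd
    rw [Finset.sum_mul_sum, ← sum_vtx K]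
    refine Finset.sum_congr rfl fun v _ => ?_
    rw [Finset.sum_eq_single v (fun u _ hu => ?_) (by simp), hcd]
    rw [← hc v, ← hd u, mul_assoc, ← mul_assoc (vtx K v), vtx_mul_of_ne K hu.symm, zero_mul,
      mul_zero]
  have hleft : ∀ c : V → LeavittPathAlgebra K V, (∀ v, vtx K v * c v = c v) → ∀ v,
      vtx K v * ∑ u, c u = c v := by
    intro c hc v
    rw [Finset.mul_sum, Finset.sum_eq_single v (fun u _ hu => ?_) (by simp), hc]
    rw [← hc u, ← mul_assoc, vtx_mul_of_ne K hu.symm, zero_mul]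
  have hright : ∀ c : V → LeavittPathAlgebra K V, (∀ v, c v * vtx K v = c v) → ∀ v,
      (∑ u, c u) * vtx K v = c v := by
    intro c hc v
    rw [Finset.sum_mul, Finset.sum_eq_single v (fun u _ hu => ?_) (by simp), hc]
    rw [← hc u, mul_assoc, vtx_mul_of_ne K hu, mul_zero]
  let x : (LeavittPathAlgebra K V)ˣ :=
    ⟨∑ v, a v, ∑ v, b v, hprod a b hap hpb hab, hprod b a hbp hpa hba⟩
  refine gkDim_le_one_of_unit (p := vtx K) x (vtx_mul_self K) (fun _ _ => vtx_mul_of_ne K)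
    (fun v => (hleft a hpa v).trans (hright a hap v).symm) ?_
  intro F hmono hmul h0 h1 h2 y
  obtain ⟨y, rfl⟩ := RingQuot.mkAlgHom_surjective K (Rel K V) y
  change ∃ m, quot K V y ∈ F m
  induction y using FreeAlgebra.induction with
  | grade0 r =>
    refine ⟨0, ?_⟩
    -- Scalars have degree `0` because `1` is the sum of the vertices.
    rw [AlgHom.commutes, Algebra.algebraMap_eq_smul_one, ← sum_vtx K]
    exact Submodule.smul_mem _ _ (Submodule.sum_mem _ fun v _ => h0 v)
  | grade1 g =>
    cases g with
    | vertex v => exact ⟨0, h0 v⟩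
    | edge e =>
      refine ⟨1, ?_⟩
      have := h1 e.left
      rw [show vtx K e.left * (x : LeavittPathAlgebra K V) = a e.left from hleft a hpa _,
        ← (hedge e.left e rfl).1] at this
      exact this
    | ghost e =>
      refine ⟨1, ?_⟩
      have := h2 e.left
      rw [show vtx K e.left * ((x⁻¹ : (LeavittPathAlgebra K V)ˣ) : LeavittPathAlgebra K V) =
        b e.left from hleft b hpb _, ← (hedge e.left e rfl).2] at this
      exact this
  | mul c d hc hd =>
    obtain ⟨m, hm⟩ := hc
    obtain ⟨n, hn⟩ := hd
    exact ⟨m + n, by rw [map_mul]; exact hmul m n (Submodule.mul_mem_mul hm hn)⟩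
  | add c d hc hd =>
    obtain ⟨m, hm⟩ := hc
    obtain ⟨n, hn⟩ := hd
    exact ⟨max m n, by
      rw [map_add]
      exact add_mem (hmono (le_max_left _ _) hm) (hmono (le_max_right _ _) hn)⟩

end Algebra

/-! ### The talented monoid -/

section Monoid

variable {V : Type u} [Quiver.{w} V] [Fintype (Quiver.Total V)]

theorem TalentedMonoid.of_eq_sum {v : V} (i : ℤ) (hv : (outEdges v).Nonempty) :
    TalentedMonoid.of v i = ∑ e ∈ outEdges v, TalentedMonoid.of e.right (i + 1) := by
  have h := AddConGen.Rel.of _ _ (TalentedRel.expand v i hv)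
  change (addConGen (TalentedRel V)) _ _ at h
  refine Eq.trans ((AddCon.eq _).2 h) ?_
  exact map_sum (addConGen (TalentedRel V)).mk' _ _

theorem TalentedMonoid.smul_of (n : ℤ) (v : V) (i : ℤ) :
    Multiplicative.ofAdd n • TalentedMonoid.of v i = TalentedMonoid.of v (i + n) :=
  TalentedMonoid.shift_of n v i

theorem mem_idealVertices_self (v : V) : v ∈ idealVertices v :=
  Set.mem_sInter.2 fun _ hI => hI.2

/-- Order-ideals are closed under summands and shifts: `r(e)(1)` is a summand of `s(e)(0)`, and
shifting by `-1` returns it to level `0`. -/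
theorem right_mem_idealVertices (e : Quiver.Total V) : e.right ∈ idealVertices e.left := by
  classical
  refine Set.mem_sInter.2 fun I ⟨⟨_, hI⟩, he⟩ => ?_
  have hmem : e ∈ outEdges e.left := mem_outEdges.2 rfl
  rw [TalentedMonoid.of_eq_sum 0 ⟨e, hmem⟩, ← Finset.add_sum_erase _ _ hmem] at he
  have h1 : TalentedMonoid.of e.right (0 + 1) ∈ I := by
    rw [← one_smul (Multiplicative ℤ) (TalentedMonoid.of e.right (0 + 1)),
      ← one_smul (Multiplicative ℤ) (Finset.sum _ _)] at he
    exact ((hI 1 1 _ _).1 he).1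
  -- The ideal condition speaks only of sums of two terms, so the shifted element is paired with the
  -- unshifted one and then split off.
  have h2 := (hI (Multiplicative.ofAdd (-1)) 1 (TalentedMonoid.of e.right (0 + 1))
    (TalentedMonoid.of e.right (0 + 1))).2 ⟨h1, h1⟩
  have h3 : Multiplicative.ofAdd (-1 : ℤ) • TalentedMonoid.of e.right (0 + 1) +
      (1 : Multiplicative ℤ) • TalentedMonoid.of e.right (0 + 1) ∈ I := h2
  rw [TalentedMonoid.smul_of, ← one_smul (Multiplicative ℤ) (TalentedMonoid.of e.right (0 + 1 + -1))]
    at h3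
  simpa using ((hI 1 1 _ _).1 h3).1

theorem idealVertices_eq_singleton (h : IsDisjointUnionOfVerticesAndLoops V) (v : V) :
    idealVertices v = {v} := by
  classical
  refine Set.Subset.antisymm (fun u hu => ?_) (by simpa using mem_idealVertices_self v)
  by_contra hne
  -- Counts the symbols `u(i)`, ignoring the level `i`. It respects the relations since an isolated
  -- loop gives `w(i) = w(i+1)` and an isolated vertex gives none.
  let φ₀ : ((V × ℤ) →₀ ℕ) →+ ℕ :=
    Finsupp.liftAddHom fun q => AddMonoidHom.mulRight (if q.1 = u then 1 else 0)
  have hφ₀ : ∀ w (i : ℤ), φ₀ (Finsupp.single (w, i) 1) = if w = u then 1 else 0 := by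
    intro w i
    simp [φ₀]
  let φ : TalentedMonoid V →+ ℕ := (addConGen (TalentedRel V)).lift φ₀ <| by
    refine AddCon.addConGen_le.2 ?_
    rintro _ _ ⟨w, i, hw⟩
    change φ₀ _ = φ₀ _
    obtain ⟨e, he⟩ := hw
    have hew : e.left = w := mem_outEdges.1 he
    rcases h w with hw | ⟨f, hl, hr, hu⟩
    · exact absurd hew (hw e).1
    · have hout : outEdges w = {f} := by
        ext g
        rw [mem_outEdges, Finset.mem_singleton]
        exact ⟨fun hg => hu g (.inl hg), fun hg => hg ▸ hl⟩
      rw [hout, Finset.sum_singleton, hφ₀, hφ₀, hr]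
  have hφ : ∀ w (i : ℤ), φ (TalentedMonoid.of w i) = if w = u then 1 else 0 := hφ₀
  have hshift : ∀ (n : Multiplicative ℤ) x, φ (n • x) = φ x := by
    intro n x
    have : φ.comp (TalentedMonoid.shift V n.toAdd) = φ :=
      TalentedMonoid.hom_ext fun w i => by simp [TalentedMonoid.shift_of, hφ]
    exact DFunLike.congr_fun this x
  have hI : IsOrderIdeal (Multiplicative ℤ) {x : TalentedMonoid V | φ x = 0} := by
    refine ⟨⟨0, map_zero φ⟩, fun α β a b => ?_⟩
    simp only [Set.mem_ofPred_eq, map_add, hshift, Nat.add_eq_zero_iff]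
  have h0 : φ (TalentedMonoid.of u 0) = 0 :=
    Set.mem_sInter.1 hu _ ⟨hI, by
      change φ _ = 0
      rw [hφ, if_neg (fun hv => hne hv.symm)]⟩
  simp [hφ] at h0

end Monoid

end LPA

theorem mainTheorem9 {K : Type*} [Field K] {V : Type u} [Quiver.{w} V] [Fintype V]
    [Fintype (Quiver.Total V)] :
    LPA.IsDisjointUnionOfVerticesAndLoops V ↔
      LPA.gkDim K (LPA.LeavittPathAlgebra K V) ≤ 1 ∧
        ∀ v : V, LPA.idealVertices v = {v} := by
  refine ⟨fun h => ⟨LPA.gkDim_le_one K h, LPA.idealVertices_eq_singleton h⟩, ?_⟩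
  rintro ⟨hdim, hideal⟩ v
  have hloop : ∀ e : Quiver.Total V, e.right = e.left := fun e => by
    simpa [hideal] using LPA.right_mem_idealVertices e
  by_cases hv : ∃ e : Quiver.Total V, e.left = v
  · obtain ⟨e, he⟩ := hv
    refine .inr ⟨e, he, (hloop e).trans he, fun f hf => ?_⟩
    rw [hloop f, or_self] at hf
    by_contra hne
    exact (LPA.one_lt_gkDim_of_two_loops K (fun g => by rw [hloop g]) hf he hne).not_ge hdim
  · refine .inl fun e => ?_
    rw [hloop e, and_self]
    exact fun he => hv ⟨e, he⟩
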